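/- Let $K$ be an infinite field and let $A=\bigoplus_{i=0}^{c}A_i$ be a commutative graded Artinian $K$-algebra with $A_0=K$, $A_c\neq 0$, generated over $K$ by $A_1$. Let $z,y\in A_1$ be linearly independent linear forms, and let $T$ be the Young diagram whose row lengths $n_1\ge n_2\ge\dots\ge n_r>0$ are the sizes of the Jordan blocks of the nilpotent endomorphism $\times z\in\operatorname{End}(A)$. Let $f_1>f_2>\dots>f_s$ be the distinct values among the $n_i$, and let $m_i$ be the multiplicity of $f_i$. Number the boxes of $T$ vertically: down the first column, then down the second column, and so on. The Jordan second canonical form of type $T$ is the square matrix whose $(a,b)$ entry is $1$ if box $b$ is next to and on the right of box $a$, and $0$ otherwise. Let $J$ and $M$ be the matrices of $\times z$ and $\times y$ in a basis of $A$ in which $J$ is the Jordan second canonical form of type $T$ (either convention may be used for the matrix of an endomorphism, images of basis vectors as columns or as rows, the same for $J$ and $M$). Let $N_1$ be the diagonal block of $M$ whose rows and columns are numbered by the boxes in the first column of $T$, and let $G_i$ ($1\le i\le s$) be the $m_i\times m_i$ diagonal block of $N_1$ given by those boxes of the first column that lie in rows of length $f_i$. (i) For all but finitely many $\lambda\in K$,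 $$\operatorname{rank}G_1^{f_1}+\operatorname{rank}G_2^{f_2}+\dots+\operatorname{rank}G_s^{f_s}+\operatorname{rank}J\ \le\ \operatorname{rank}(M+\lambda J),$$ where $\operatorname{rank}(M+\lambda J)$ is the rank of $\times(y+\lambda z)\in\operatorname{End}(A)$ and $\operatorname{rank}J$ that of $\times z$. (ii) If $$\operatorname{rank}G_1^{f_1}+\dots+\operatorname{rank}G_s^{f_s}+\operatorname{rank}J=\sum_{i=0}^{c-1}\min\{\dim_K A_i,\dim_K A_{i+1}\}$$ (the right-hand side is the CoSperner number of $A$), then for all but finitely many $\lambda\in K$ the form $y+\lambda z$ is a weak Lefschetz element of $A$, that is, for each $i=0,\dots,c-1$ the map $\times(y+\lambda z)\colon A_i\to A_{i+1}$ is injective or surjective. -/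

import Mathlib

/-! Matrices whose rows and columns are numbered by the boxes of a Young diagram. In Mathlib a box of a
`YoungDiagram` is a pair `(i, j)` = (row, column), counted from `0`; `T.card` is the number of boxes,
`T.rowLen i` the length of the `i`-th row and `T.rowLens` the list `n₁ ≥ n₂ ≥ ⋯ ≥ n_r > 0` of the
lengths of the (non-empty) rows. -/

namespace JordanSecond

/-- The boxes of `T`, written as (column, row) with the lexicographic order. -/
def columnLex (T : YoungDiagram) : Finset (ℕ ×ₗ ℕ) :=
  T.cells.map ((Equiv.prodComm ℕ ℕ).trans toLex).toEmbedding

theorem card_columnLex (T : YoungDiagram) : (columnLex T).card = T.card :=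
  Finset.card_map _

/-- The box that carries the number `a` in the vertical numbering of `T` (down the first column, then
down the second column, and so on), as a pair (row, column). -/
def box (T : YoungDiagram) (a : Fin T.card) : ℕ × ℕ :=
  (ofLex ((columnLex T).orderIsoOfFin (card_columnLex T) a : ℕ ×ₗ ℕ)).swap

/-- The Jordan second canonical form of type `T`: boxes are numbered vertically, and the `(a, b)` entry
is `1` if box `b` is next to and on the right of box `a`, and `0` otherwise. -/
def jordanSecond (K : Type*) [Field K] (T : YoungDiagram) : Matrix (Fin T.card) (Fin T.card) K :=
  Matrix.of fun a b =>
    if (box T b).1 = (box T a).1 ∧ (box T b).2 = (box T a).2 + 1 then 1 else 0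

/-- The coarse diagonal block of `M` that belongs to the `j`-th column of `T` (so `N_{j+1}`, as columns
are counted from `0`): it is a square matrix whose size is the length of that column. -/
def coarseBlock {K : Type*} [Field K] (T : YoungDiagram) (M : Matrix (Fin T.card) (Fin T.card) K)
    (j : ℕ) : Matrix {a : Fin T.card // (box T a).2 = j} {a : Fin T.card // (box T a).2 = j} K :=
  M.toSquareBlock (fun a => (box T a).2) j

/-- The diagonal block of the first coarse diagonal block `N₁` of `M` that belongs to the rows of `T` of
length `f`. If `f₁ > ⋯ > f_s` are the distinct row lengths, `fineBlock T M f_i` is the block `G_i`; its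
size is the multiplicity `m_i` of `f_i`. -/
def fineBlock {K : Type*} [Field K] (T : YoungDiagram) (M : Matrix (Fin T.card) (Fin T.card) K)
    (f : ℕ) :
    Matrix {a : {a : Fin T.card // (box T a).2 = 0} // T.rowLen (box T a.1).1 = f}
      {a : {a : Fin T.card // (box T a).2 = 0} // T.rowLen (box T a.1).1 = f} K :=
  (coarseBlock T M 0).toSquareBlock (fun a => T.rowLen (box T a.1).1) f

/-- `∑ i, rank (G_i ^ f_i)`, the sum over the distinct row lengths `f₁ > ⋯ > f_s` of `T`. -/
noncomputable def sumRankFinePow {K : Type*} [Field K] (T : YoungDiagram)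
    (M : Matrix (Fin T.card) (Fin T.card) K) : ℕ :=
  ∑ f ∈ T.rowLens.toFinset, (fineBlock T M f ^ f).rank

end JordanSecond

/-- The grading `A = A₀ ⊕ ⋯ ⊕ A_c` is standard with last non-zero component `A_c`: `A₀ = K`, the algebra
is generated over `K` by `A₁`, `A_c ≠ 0`, and `A_i = 0` for `i > c`. -/
structure IsStandardGrading {K A : Type*} [Field K] [CommRing A] [Algebra K A]
    (𝒜 : ℕ → Submodule K A) [GradedAlgebra 𝒜] (c : ℕ) : Prop where
  zero_eq : 𝒜 0 = Submodule.span K {(1 : A)}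
  adjoin_one : Algebra.adjoin K (𝒜 1 : Set A) = ⊤
  top_ne : 𝒜 c ≠ ⊥
  eq_bot_of_lt : ∀ i, c < i → 𝒜 i = ⊥

/-- The CoSperner number `∑_{i=0}^{c-1} min (dim A_i) (dim A_{i+1})`. -/
noncomputable def coSperner {K A : Type*} [Field K] [CommRing A] [Algebra K A]
    (𝒜 : ℕ → Submodule K A) (c : ℕ) : ℕ :=
  ∑ i ∈ Finset.range c, min (Module.finrank K (𝒜 i)) (Module.finrank K (𝒜 (i + 1)))

/-- `ℓ` is a linear form such that multiplication by `ℓ` from `A_i` to `A_{i+1}` is injective or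
surjective for every `i = 0, …, c - 1`. -/
def IsWeakLefschetzElement {K A : Type*} [Field K] [CommRing A] [Algebra K A]
    (𝒜 : ℕ → Submodule K A) (c : ℕ) (ℓ : A) : Prop :=
  ℓ ∈ 𝒜 1 ∧ ∀ i < c, Set.InjOn (fun a => ℓ * a) (𝒜 i : Set A) ∨
    Set.SurjOn (fun a => ℓ * a) (𝒜 i : Set A) (𝒜 (i + 1) : Set A)

/-- `X` is the matrix of the endomorphism `φ` in the basis `b`, under the convention that the image of
the `i`-th basis vector is read off the `i`-th column of `X` (`rows = false`), or under the
convention that it is read off the `i`-th row (`rows = true`). -/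
def IsMatrixOf {K V ι : Type*} [Field K] [AddCommGroup V] [Module K V] [Fintype ι] [DecidableEq ι]
    (rows : Bool) (b : Module.Basis ι K V) (φ : V →ₗ[K] V) (X : Matrix ι ι K) : Prop :=
  if rows then X.transpose = LinearMap.toMatrix b b φ else X = LinearMap.toMatrix b b φ

theorem Matrix.exists_mul_mul_eq_one {K m n : Type*} [Field K] [Fintype m] [Fintype n]
    [DecidableEq m] [DecidableEq n] (P : Matrix m n K) :
    ∃ (U : Matrix (Fin P.rank) m K) (W : Matrix n (Fin P.rank) K), U * P * W = 1 := by
  set φ := P.mulVecLin with hφ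
  have hr : Module.finrank K (LinearMap.range φ) = P.rank := rfl
  let e : LinearMap.range φ ≃ₗ[K] (Fin P.rank → K) := (Module.finBasisOfFinrankEq K _ hr).equivFun
  obtain ⟨s, hs⟩ := φ.rangeRestrict.exists_rightInverse_of_surjective φ.range_rangeRestrict
  obtain ⟨l, hl⟩ := (LinearMap.range φ).subtype.exists_leftInverse_of_injective
    (LinearMap.range φ).ker_subtype
  refine ⟨LinearMap.toMatrix' (e.toLinearMap ∘ₗ l),
    LinearMap.toMatrix' (s ∘ₗ e.symm.toLinearMap), ?_⟩
  have hP : P = LinearMap.toMatrix' φ := by rw [hφ, ← Matrix.toLin'_apply', LinearMap.toMatrix'_toLin']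
  have h : (e.toLinearMap ∘ₗ l) ∘ₗ φ ∘ₗ (s ∘ₗ e.symm.toLinearMap) = LinearMap.id := by
    refine LinearMap.ext fun x => ?_
    have h1 : φ (s (e.symm x)) = ((e.symm x : LinearMap.range φ) : m → K) :=
      congrArg Subtype.val (LinearMap.congr_fun hs (e.symm x))
    have h2 := LinearMap.congr_fun hl (e.symm x)
    simp only [LinearMap.comp_apply, Submodule.subtype_apply, LinearMap.id_apply,
      LinearEquiv.coe_coe] at h2 ⊢
    rw [h1, h2, e.apply_symm_apply]
  have h3 := congrArg LinearMap.toMatrix' h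
  rw [LinearMap.toMatrix'_comp, LinearMap.toMatrix'_comp, LinearMap.toMatrix'_id, ← hP] at h3
  rw [Matrix.mul_assoc]; exact h3

/-- Lower semicontinuity of the rank in a polynomial family of matrices. -/
theorem Matrix.eventually_rank_eval_le {K m n : Type*} [Field K] [Fintype m] [Fintype n]
    [DecidableEq m] [DecidableEq n] (P : Matrix m n (Polynomial K)) (t₀ : K) :
    ∀ᶠ t in Filter.cofinite,
      (P.map (Polynomial.eval t₀)).rank ≤ (P.map (Polynomial.eval t)).rank := by
  obtain ⟨U, W, h⟩ := (P.map (Polynomial.eval t₀)).exists_mul_mul_eq_one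
  set p : Polynomial K := (U.map Polynomial.C * P * W.map Polynomial.C).det with hp
  have hev : ∀ t, p.eval t = (U * P.map (Polynomial.eval t) * W).det := fun t => by
    rw [hp, ← Polynomial.coe_evalRingHom, RingHom.map_det, RingHom.mapMatrix_apply,
      Matrix.map_mul, Matrix.map_mul]
    congr 2
    · congr 1
      ext; simp
    · ext; simp
  have hp0 : p ≠ 0 := by
    rintro h0
    have := hev t₀
    rw [h, h0] at this
    simp at this
  have hfin : {t : K | p.IsRoot t}.Finite := Polynomial.finite_setOfPred_isRoot hp0
  refine Filter.mem_cofinite.2 (hfin.subset fun t ht => ?_)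
  by_contra hroot
  refine ht ?_
  have hdet : IsUnit (U * P.map (Polynomial.eval t) * W).det :=
    isUnit_iff_ne_zero.2 (by rw [← hev]; exact hroot)
  have h1 := Matrix.rank_of_isUnit _ ((Matrix.isUnit_iff_isUnit_det _).2 hdet)
  rw [Fintype.card_fin] at h1
  calc _ = (U * P.map (Polynomial.eval t) * W).rank := h1.symm
    _ ≤ (U * P.map (Polynomial.eval t)).rank := Matrix.rank_mul_le_left _ _
    _ ≤ _ := Matrix.rank_mul_le_right _ _

namespace JordanSecond

variable {K : Type*} [Field K] {T : YoungDiagram}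

theorem box_injective (T : YoungDiagram) : Function.Injective (box T) := fun a b h => by
  have := Prod.swap_injective h
  simpa using this

theorem exists_box_eq_iff {p : ℕ × ℕ} : (∃ a, box T a = p) ↔ p.2 < T.rowLen p.1 := by
  rw [← YoungDiagram.mem_iff_lt_rowLen]
  constructor
  · rintro ⟨a, rfl⟩
    have := ((columnLex T).orderIsoOfFin (card_columnLex T) a).2
    obtain ⟨q, hq, h⟩ := Finset.mem_map.1 this
    rw [box, ← h]
    exact hq
  · intro hp
    have h : toLex p.swap ∈ columnLex T := Finset.mem_map.2 ⟨p, hp, rfl⟩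
    refine ⟨((columnLex T).orderIsoOfFin (card_columnLex T)).symm ⟨_, h⟩, ?_⟩
    simp [box]

theorem box_lt (a : Fin T.card) : (box T a).2 < T.rowLen (box T a).1 :=
  exists_box_eq_iff.1 ⟨a, rfl⟩

theorem jordanSecond_apply (a b : Fin T.card) :
    jordanSecond K T a b = if box T b = ((box T a).1, (box T a).2 + 1) then 1 else 0 := by
  simp [jordanSecond, Prod.ext_iff]

theorem jordanSecond_mulVec (v : Fin T.card → K) (a : Fin T.card) :
    (jordanSecond K T).mulVec v a =
      Function.extend (box T) v 0 ((box T a).1, (box T a).2 + 1) := by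
  simp only [Matrix.mulVec, dotProduct, jordanSecond_apply, ite_mul, one_mul, zero_mul]
  by_cases h : ∃ c, box T c = ((box T a).1, (box T a).2 + 1)
  · obtain ⟨c, hc⟩ := h
    rw [← hc, (box_injective T).extend_apply, Finset.sum_eq_single c]
    · simp
    · exact fun b _ hb => if_neg fun h => hb (box_injective T h)
    · simp
  · rw [Function.extend_apply' _ _ _ h]
    exact Finset.sum_eq_zero fun b _ => if_neg fun hb => h ⟨b, hb⟩

end JordanSecond
namespace JordanSecond
variable {K : Type*} [Field K] {T : YoungDiagram}

theorem exists_box_right {a : Fin T.card} (h : (box T a).2 + 1 < T.rowLen (box T a).1) :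
    ∃ a', box T a' = ((box T a).1, (box T a).2 + 1) :=
  exists_box_eq_iff.2 h

theorem exists_box_left {a : Fin T.card} {j : ℕ} (h : (box T a).2 = j + 1) :
    ∃ a₀, (box T a₀).1 = (box T a).1 ∧ (box T a₀).2 = j := by
  have := box_lt a
  obtain ⟨a₀, h₀⟩ := (exists_box_eq_iff (T := T) (p := ((box T a).1, j))).2
    (show j < T.rowLen (box T a).1 by lia)
  exact ⟨a₀, by rw [h₀], by rw [h₀]⟩

theorem jordanSecond_mul_apply (M : Matrix (Fin T.card) (Fin T.card) K) (a b : Fin T.card) :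
    (jordanSecond K T * M) a b =
      Function.extend (box T) (fun c => M c b) 0 ((box T a).1, (box T a).2 + 1) :=
  jordanSecond_mulVec (fun c => M c b) a

theorem mul_jordanSecond_apply_right (M : Matrix (Fin T.card) (Fin T.card) K)
    {a b b' : Fin T.card} (h : box T b' = ((box T b).1, (box T b).2 + 1)) :
    (M * jordanSecond K T) a b' = M a b := by
  simp only [Matrix.mul_apply, jordanSecond_apply, mul_ite, mul_one, mul_zero]
  rw [Finset.sum_eq_single b]
  · simp [h]
  · refine fun c _ hc => if_neg fun h' => hc (box_injective T ?_)
    rw [h, Prod.mk.injEq] at h'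
    exact Prod.ext h'.1.symm (by lia)
  · simp

theorem mul_jordanSecond_apply_of_snd_eq_zero (M : Matrix (Fin T.card) (Fin T.card) K)
    {a b : Fin T.card} (h : (box T b).2 = 0) : (M * jordanSecond K T) a b = 0 := by
  simp only [Matrix.mul_apply, jordanSecond_apply, mul_ite, mul_one, mul_zero]
  exact Finset.sum_eq_zero fun c _ => if_neg fun h' => by simp [h'] at h

theorem apply_right_right {M : Matrix (Fin T.card) (Fin T.card) K}
    (hM : Commute (jordanSecond K T) M) {a a' b b' : Fin T.card}
    (ha : box T a' = ((box T a).1, (box T a).2 + 1))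
    (hb : box T b' = ((box T b).1, (box T b).2 + 1)) : M a' b' = M a b := by
  have := congrFun₂ hM.eq a b'
  rwa [mul_jordanSecond_apply_right M hb, jordanSecond_mul_apply, ← ha,
    (box_injective T).extend_apply] at this

theorem apply_right_eq_zero {M : Matrix (Fin T.card) (Fin T.card) K}
    (hM : Commute (jordanSecond K T) M) {a a' b : Fin T.card}
    (ha : box T a' = ((box T a).1, (box T a).2 + 1)) (hb : (box T b).2 = 0) : M a' b = 0 := by
  have := congrFun₂ hM.eq a b
  rwa [mul_jordanSecond_apply_of_snd_eq_zero M hb, jordanSecond_mul_apply, ← ha,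
    (box_injective T).extend_apply] at this

theorem apply_eq_zero_of_right {M : Matrix (Fin T.card) (Fin T.card) K}
    (hM : Commute (jordanSecond K T) M) {a b b' : Fin T.card}
    (ha : T.rowLen (box T a).1 ≤ (box T a).2 + 1)
    (hb : box T b' = ((box T b).1, (box T b).2 + 1)) : M a b = 0 := by
  have := congrFun₂ hM.eq a b'
  rw [mul_jordanSecond_apply_right M hb, jordanSecond_mul_apply, Function.extend_apply'] at this
  · exact this.symm
  · rw [exists_box_eq_iff]
    exact not_lt.2 ha

theorem snd_le_snd_of_apply_ne_zero {M : Matrix (Fin T.card) (Fin T.card) K}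
    (hM : Commute (jordanSecond K T) M) {a b : Fin T.card} (h : M a b ≠ 0) :
    (box T a).2 ≤ (box T b).2 := by
  induction hj : (box T a).2 generalizing a b with
  | zero => exact Nat.zero_le _
  | succ j ih =>
    obtain ⟨a₀, ha₁, ha₂⟩ := exists_box_left hj
    have ha : box T a = ((box T a₀).1, (box T a₀).2 + 1) := Prod.ext ha₁.symm (by simp [ha₂, hj])
    rcases hk : (box T b).2 with _ | k
    · exact absurd (apply_right_eq_zero hM ha hk) h
    · obtain ⟨b₀, hb₁, hb₂⟩ := exists_box_left hk
      have hb : box T b = ((box T b₀).1, (box T b₀).2 + 1) := Prod.ext hb₁.symm (by simp [hb₂, hk])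
      rw [apply_right_right hM ha hb] at h
      have := ih h ha₂
      lia

theorem rowLen_add_le_of_apply_ne_zero {M : Matrix (Fin T.card) (Fin T.card) K}
    (hM : Commute (jordanSecond K T) M) {a b : Fin T.card} (h : M a b ≠ 0) :
    T.rowLen (box T b).1 + (box T a).2 ≤ T.rowLen (box T a).1 + (box T b).2 := by
  induction hn : T.rowLen (box T a).1 - (box T a).2 generalizing a b with
  | zero => have := box_lt a; lia
  | succ n ih =>
    by_cases hb : (box T b).2 + 1 < T.rowLen (box T b).1
    · obtain ⟨b', hb'⟩ := exists_box_right hb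
      by_cases ha : (box T a).2 + 1 < T.rowLen (box T a).1
      · obtain ⟨a', ha'⟩ := exists_box_right ha
        rw [← apply_right_right hM ha' hb'] at h
        have := ih h (by simp only [ha']; lia)
        simp only [ha', hb'] at this
        lia
      · exact absurd (apply_eq_zero_of_right hM (not_lt.1 ha) hb') h
    · have := box_lt a
      lia

theorem apply_eq_apply_of_snd_eq {M : Matrix (Fin T.card) (Fin T.card) K}
    (hM : Commute (jordanSecond K T) M) {a b a₀ b₀ : Fin T.card}
    (hab : (box T a).2 = (box T b).2)
    (ha : (box T a₀).1 = (box T a).1) (ha₀ : (box T a₀).2 = 0)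
    (hb : (box T b₀).1 = (box T b).1) (hb₀ : (box T b₀).2 = 0) : M a b = M a₀ b₀ := by
  induction hj : (box T a).2 generalizing a b with
  | zero =>
    rw [box_injective T (Prod.ext ha (ha₀.trans hj.symm)),
      box_injective T (Prod.ext hb (hb₀.trans (hj.symm.trans hab)))]
  | succ j ih =>
    obtain ⟨a₁, h₁, h₂⟩ := exists_box_left hj
    obtain ⟨b₁, h₃, h₄⟩ := exists_box_left (hab.symm.trans hj)
    rw [apply_right_right hM (a := a₁) (b := b₁) (Prod.ext h₁.symm (by simp [h₂, hj]))
      (Prod.ext h₃.symm (by simp [h₄, ← hab, hj]))]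
    exact ih (h₂.trans h₄.symm) (ha.trans h₁.symm) (hb.trans h₃.symm) h₂

/-- The part of `M` that joins boxes of the same column lying in rows of the same length. -/
def fineDiagonal (T : YoungDiagram) (M : Matrix (Fin T.card) (Fin T.card) K) :
    Matrix (Fin T.card) (Fin T.card) K :=
  Matrix.of fun a b =>
    if (box T b).2 = (box T a).2 ∧ T.rowLen (box T b).1 = T.rowLen (box T a).1 then M a b else 0

/-- The entries of `v` at the boxes of the `j`-th column that lie in rows of length `f`, indexed by
the rows. -/
noncomputable def columnPart (T : YoungDiagram) (f j : ℕ) : (Fin T.card → K) →ₗ[K]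
    ({a : {a : Fin T.card // (box T a).2 = 0} // T.rowLen (box T a.1).1 = f} → K) where
  toFun v a := Function.extend (box T) v 0 ((box T a.1.1).1, j)
  map_add' v w := funext fun a => by
    simpa using congrFun (Function.extend_add (box T) v w 0 0) ((box T a.1.1).1, j)
  map_smul' r v := funext fun a => by
    simpa using congrFun (Function.extend_smul r (box T) v 0) ((box T a.1.1).1, j)

theorem columnPart_eq_zero_of_le {f j : ℕ} (h : f ≤ j) (v : Fin T.card → K) :
    columnPart T f j v = 0 := funext fun a => by
  refine Function.extend_apply' _ _ _ ?_
  rw [exists_box_eq_iff]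
  exact not_lt.2 (a.2.trans_le h)

theorem fineDiagonal_mulVec {M : Matrix (Fin T.card) (Fin T.card) K}
    (hM : Commute (jordanSecond K T) M) (v : Fin T.card → K) {f j : ℕ}
    (α : {a : {a : Fin T.card // (box T a).2 = 0} // T.rowLen (box T a.1).1 = f})
    {a : Fin T.card} (ha : box T a = ((box T α.1.1).1, j)) :
    (fineDiagonal T M).mulVec v a = (fineBlock T M f).mulVec (columnPart T f j v) α := by
  have hf : T.rowLen (box T α.1.1).1 = f := α.2
  have hj : j < f := by have := box_lt a; rw [ha] at this; exact this.trans_eq hf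
  have hex : ∀ β : {a : {a : Fin T.card // (box T a).2 = 0} // T.rowLen (box T a.1).1 = f},
      ∃ b, box T b = ((box T β.1.1).1, j) := fun β => exists_box_eq_iff.2 (hj.trans_eq β.2.symm)
  choose g hg using hex
  simp only [Matrix.mulVec, dotProduct, fineDiagonal, Matrix.of_apply, ha, hf, ite_mul, zero_mul]
  rw [← Finset.sum_filter]
  symm
  refine Finset.sum_bij (fun β _ => g β) ?_ ?_ ?_ ?_
  · intro β _
    simpa [hg] using β.2
  · intro β _ γ _ h
    have h1 := congrArg (fun c => (box T c).1) h
    simp only [hg] at h1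
    exact Subtype.ext (Subtype.ext (box_injective T (Prod.ext h1 (β.1.2.trans γ.1.2.symm))))
  · intro b hb
    rw [Finset.mem_filter] at hb
    obtain ⟨b₀, hb₀⟩ := (exists_box_eq_iff (T := T) (p := ((box T b).1, 0))).2
      (Nat.zero_lt_of_lt (box_lt b))
    refine ⟨⟨⟨b₀, by rw [hb₀]⟩, by simpa [hb₀] using hb.2.2⟩, Finset.mem_univ _, ?_⟩
    refine box_injective T ?_
    rw [hg]
    exact Prod.ext (by simp [hb₀]) hb.2.1.symm
  · intro β _
    rw [apply_eq_apply_of_snd_eq hM (a := a) (b := g β) (a₀ := α.1.1) (b₀ := β.1.1)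
      (by simp [ha, hg]) (by simp [ha]) α.1.2 (by simp [hg]) β.1.2,
      ← (box_injective T).extend_apply v 0 (g β), hg]
    rfl

theorem columnPart_eq_of_mem_ker {M : Matrix (Fin T.card) (Fin T.card) K}
    (hM : Commute (jordanSecond K T) M) {v : Fin T.card → K}
    (hv : (fineDiagonal T M + jordanSecond K T).mulVec v = 0) (f j : ℕ) (hj : j ≤ f) :
    columnPart T f j v = ((-fineBlock T M f) ^ j).mulVec (columnPart T f 0 v) := by
  induction j with
  | zero => simp
  | succ j ih =>
    rw [pow_succ', ← Matrix.mulVec_mulVec, ← ih (by lia)]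
    funext α
    obtain ⟨a, ha⟩ := (exists_box_eq_iff (T := T) (p := ((box T α.1.1).1, j))).2
      (by simp only [α.2]; lia)
    have h := congrFun hv a
    rw [Matrix.add_mulVec, Pi.add_apply, fineDiagonal_mulVec hM v α ha, jordanSecond_mulVec, ha] at h
    rw [Matrix.neg_mulVec, Pi.neg_apply]
    exact eq_neg_of_add_eq_zero_right h

theorem rowLen_mem_rowLens (a : Fin T.card) : T.rowLen (box T a).1 ∈ T.rowLens.toFinset := by
  rw [List.mem_toFinset, YoungDiagram.rowLens, List.mem_map]
  refine ⟨_, List.mem_range.2 ?_, rfl⟩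
  rw [← YoungDiagram.mem_iff_lt_colLen, YoungDiagram.mem_iff_lt_rowLen]
  exact Nat.zero_lt_of_lt (box_lt a)

theorem finrank_ker_fineDiagonal_add_le {M : Matrix (Fin T.card) (Fin T.card) K}
    (hM : Commute (jordanSecond K T) M) :
    Module.finrank K (LinearMap.ker (fineDiagonal T M + jordanSecond K T).mulVecLin) ≤
      ∑ f ∈ T.rowLens.toFinset, Module.finrank K (LinearMap.ker (fineBlock T M f ^ f).mulVecLin) := by
  rw [← Finset.sum_coe_sort, ← Module.finrank_pi_fintype K]
  have hmem : ∀ (f : T.rowLens.toFinset)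
      (v : LinearMap.ker (fineDiagonal T M + jordanSecond K T).mulVecLin),
      columnPart T f.1 0 v.1 ∈ LinearMap.ker (fineBlock T M f.1 ^ f.1).mulVecLin := fun f v => by
    have h := columnPart_eq_of_mem_ker hM (v := v.1) v.2 f.1 f.1 le_rfl
    rw [columnPart_eq_zero_of_le le_rfl] at h
    rw [LinearMap.mem_ker, Matrix.mulVecLin_apply]
    rcases Nat.even_or_odd f.1 with h1 | h1
    · rw [h1.neg_pow] at h
      exact h.symm
    · rwa [h1.neg_pow, Matrix.neg_mulVec, eq_comm, neg_eq_zero] at h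
  let Φ : LinearMap.ker (fineDiagonal T M + jordanSecond K T).mulVecLin →ₗ[K]
      ((f : T.rowLens.toFinset) → LinearMap.ker (fineBlock T M f.1 ^ f.1).mulVecLin) :=
    LinearMap.pi fun f =>
      ((columnPart T f.1 0).comp (Submodule.subtype _)).codRestrict _ (hmem f)
  refine LinearMap.finrank_le_finrank_of_injective (f := Φ) ?_
  rw [← LinearMap.ker_eq_bot, LinearMap.ker_eq_bot']
  refine fun v hv => Subtype.ext (funext fun a => ?_)
  obtain ⟨a₀, ha₀⟩ := (exists_box_eq_iff (T := T) (p := ((box T a).1, 0))).2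
    (Nat.zero_lt_of_lt (box_lt a))
  have h0 : columnPart T (T.rowLen (box T a).1) 0 v.1 = 0 :=
    congrArg Subtype.val (congrFun hv ⟨_, rowLen_mem_rowLens a⟩)
  have h1 := columnPart_eq_of_mem_ker hM (v := v.1) v.2 _ _ (box_lt a).le
  rw [h0, Matrix.mulVec_zero] at h1
  have h2 := congrFun h1 ⟨⟨a₀, by rw [ha₀]⟩, by rw [ha₀]⟩
  have h3 : Function.extend (box T) v.1 0 ((box T a₀).1, (box T a).2) = 0 := h2
  rw [ha₀] at h3
  exact ((box_injective T).extend_apply v.1 0 a).symm.trans h3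

theorem rank_jordanSecond_le :
    (jordanSecond K T).rank ≤ Fintype.card {a : Fin T.card // ¬ (box T a).2 = 0} := by
  rw [← Matrix.rank_transpose, Fintype.card_subtype]
  refine Matrix.rank_le_card_of_support_subset _ _ fun b hb => ?_
  rw [Finset.coe_filter_univ, Set.mem_ofPred_eq]
  refine fun h => hb (funext fun a => ?_)
  rw [Matrix.row_apply, Matrix.transpose_apply, jordanSecond_apply]
  exact if_neg fun h' => by simp [h'] at h

theorem sum_card_fine : ∑ f ∈ T.rowLens.toFinset, Fintype.card
      {a : {a : Fin T.card // (box T a).2 = 0} // T.rowLen (box T a.1).1 = f} =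
    Fintype.card {a : Fin T.card // (box T a).2 = 0} := by
  rw [← Finset.card_univ, Finset.card_eq_sum_card_fiberwise
    (f := fun a : {a : Fin T.card // (box T a).2 = 0} => T.rowLen (box T a.1).1)
    (t := T.rowLens.toFinset) fun a _ => rowLen_mem_rowLens a.1]
  exact Finset.sum_congr rfl fun f _ => Fintype.card_subtype _

theorem sumRankFinePow_add_rank_le {M : Matrix (Fin T.card) (Fin T.card) K}
    (hM : Commute (jordanSecond K T) M) :
    sumRankFinePow T M + (jordanSecond K T).rank ≤ (fineDiagonal T M + jordanSecond K T).rank := by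
  have h1 := finrank_ker_fineDiagonal_add_le hM
  have h2 := (fineDiagonal T M + jordanSecond K T).mulVecLin.finrank_range_add_finrank_ker
  have h3 := rank_jordanSecond_le (K := K) (T := T)
  have h4 := Fintype.card_subtype_compl fun a : Fin T.card => (box T a).2 = 0
  have h5 := Fintype.card_subtype_le fun a : Fin T.card => (box T a).2 = 0
  have h6 : sumRankFinePow T M +
      ∑ f ∈ T.rowLens.toFinset, Module.finrank K (LinearMap.ker (fineBlock T M f ^ f).mulVecLin) =
      Fintype.card {a : Fin T.card // (box T a).2 = 0} := by
    rw [← sum_card_fine, sumRankFinePow, ← Finset.sum_add_distrib]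
    refine Finset.sum_congr rfl fun f _ => ?_
    rw [Matrix.rank, LinearMap.finrank_range_add_finrank_ker, Module.finrank_fintype_fun_eq_card]
  rw [Module.finrank_fintype_fun_eq_card] at h2
  change (fineDiagonal T M + jordanSecond K T).rank + _ = _ at h2
  lia
end JordanSecond

theorem finrank_range_mulLeft_le {K A : Type*} [Field K] [CommRing A] [Algebra K A]
    [FiniteDimensional K A] (𝒜 : ℕ → Submodule K A) [GradedAlgebra 𝒜] {c : ℕ}
    (hc : ∀ i, c < i → 𝒜 i = ⊥) {l : A} (hl : l ∈ 𝒜 1) :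
    Module.finrank K (LinearMap.range (LinearMap.mulLeft K l)) ≤
      ∑ i ∈ Finset.range c, Module.finrank K ((𝒜 i).map (LinearMap.mulLeft K l)) := by
  have hle : ∀ s : Finset ℕ, Module.finrank K
      (s.sup fun i => (𝒜 i).map (LinearMap.mulLeft K l) : Submodule K A) ≤
      ∑ i ∈ s, Module.finrank K ((𝒜 i).map (LinearMap.mulLeft K l)) := fun s => by
    induction s using Finset.induction_on with
    | empty => simp
    | insert i s hi ih =>
      rw [Finset.sup_insert, Finset.sum_insert hi]
      exact (Submodule.finrank_add_le_finrank_add_finrank _ _).trans (Nat.add_le_add_left ih _)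
  refine le_trans (Submodule.finrank_mono ?_) (hle _)
  rw [LinearMap.range_eq_map, ← (DirectSum.Decomposition.isInternal 𝒜).submodule_iSup_eq_top,
    Submodule.map_iSup]
  refine iSup_le fun i => ?_
  rcases lt_or_ge i c with h | h
  · exact Finset.le_sup (f := fun i => (𝒜 i).map (LinearMap.mulLeft K l)) (Finset.mem_range.2 h)
  · rintro _ ⟨a, ha, rfl⟩
    have h1 : l * a ∈ 𝒜 (1 + i) := SetLike.mul_mem_graded hl ha
    rw [hc _ (by lia), Submodule.mem_bot] at h1
    rw [LinearMap.mulLeft_apply, h1]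
    exact zero_mem _

theorem isWeakLefschetzElement_of_coSperner_le {K A : Type*} [Field K] [CommRing A] [Algebra K A]
    [FiniteDimensional K A] (𝒜 : ℕ → Submodule K A) [GradedAlgebra 𝒜] {c : ℕ}
    (hc : ∀ i, c < i → 𝒜 i = ⊥) {l : A} (hl : l ∈ 𝒜 1)
    (h : coSperner 𝒜 c ≤ Module.finrank K (LinearMap.range (LinearMap.mulLeft K l))) :
    IsWeakLefschetzElement 𝒜 c l := by
  refine ⟨hl, fun i hi => ?_⟩
  have hmap : ∀ i, (𝒜 i).map (LinearMap.mulLeft K l) ≤ 𝒜 (i + 1) := by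
    rintro i _ ⟨a, ha, rfl⟩
    rw [add_comm]
    exact SetLike.mul_mem_graded hl ha
  have hle : ∀ i ∈ Finset.range c, Module.finrank K ((𝒜 i).map (LinearMap.mulLeft K l)) ≤
      min (Module.finrank K (𝒜 i)) (Module.finrank K (𝒜 (i + 1))) := fun i _ =>
    le_min (Submodule.finrank_map_le _ _) (Submodule.finrank_mono (hmap i))
  have heq := (Finset.sum_eq_sum_iff_of_le hle).1 (le_antisymm (Finset.sum_le_sum hle)
    (h.trans (finrank_range_mulLeft_le 𝒜 hc hl))) i (Finset.mem_range.2 hi)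
  rcases min_choice (Module.finrank K (𝒜 i)) (Module.finrank K (𝒜 (i + 1))) with h1 | h1 <;>
    rw [h1] at heq
  · left
    have h2 := ((LinearMap.mulLeft K l).domRestrict (𝒜 i)).finrank_range_add_finrank_ker
    rw [LinearMap.range_domRestrict, heq, Nat.add_eq_left, Submodule.finrank_eq_zero,
      LinearMap.ker_eq_bot] at h2
    exact fun a ha b hb hab => congrArg Subtype.val (@h2 ⟨a, ha⟩ ⟨b, hb⟩ hab)
  · right
    have h2 := Submodule.eq_of_le_of_finrank_eq (hmap i) heq
    intro x hx
    rw [SetLike.mem_coe, ← h2] at hx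
    exact hx
namespace JordanSecond
variable {K : Type*} [Field K] {T : YoungDiagram}

/-- A polynomial family with value `fineDiagonal T M + J` at `0` whose value at `t ≠ 0` is conjugate
to `M + t⁻² J` by a diagonal matrix, provided that `M` commutes with `J`. -/
noncomputable def degeneration (T : YoungDiagram) (M : Matrix (Fin T.card) (Fin T.card) K) :
    Matrix (Fin T.card) (Fin T.card) (Polynomial K) :=
  Matrix.of fun a b => Polynomial.C (M a b) * Polynomial.X ^
      ((2 * (box T b).2 + T.rowLen (box T a).1) - (2 * (box T a).2 + T.rowLen (box T b).1)) +
    Polynomial.C (jordanSecond K T a b)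

theorem degeneration_map_eval_zero {M : Matrix (Fin T.card) (Fin T.card) K}
    (hM : Commute (jordanSecond K T) M) :
    (degeneration T M).map (Polynomial.eval 0) = fineDiagonal T M + jordanSecond K T := by
  ext a b
  simp only [degeneration, fineDiagonal, Matrix.map_apply, Matrix.of_apply, Matrix.add_apply,
    Polynomial.eval_add, Polynomial.eval_mul, Polynomial.eval_C, Polynomial.eval_pow,
    Polynomial.eval_X, add_left_inj]
  by_cases h : M a b = 0
  · simp [h]
  have h1 := snd_le_snd_of_apply_ne_zero hM h
  have h2 := rowLen_add_le_of_apply_ne_zero hM h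
  split_ifs with h3
  · rw [h3.1, h3.2, Nat.sub_self, pow_zero, mul_one]
  · rw [zero_pow (by lia), mul_zero]

theorem rank_degeneration_le {M : Matrix (Fin T.card) (Fin T.card) K}
    (hM : Commute (jordanSecond K T) M) {t : K} (ht : t ≠ 0) :
    ((degeneration T M).map (Polynomial.eval t)).rank ≤
      (M + (t ^ 2)⁻¹ • jordanSecond K T).rank := by
  set w : Fin T.card → ℤ := fun a => 2 * ((box T a).2 : ℤ) - T.rowLen (box T a).1 with hw
  have h : (degeneration T M).map (Polynomial.eval t) =
      Matrix.diagonal (fun a => t ^ (-w a)) * (M + (t ^ 2)⁻¹ • jordanSecond K T) *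
        Matrix.diagonal (fun a => t ^ w a) := by
    ext a b
    rw [Matrix.mul_diagonal, Matrix.diagonal_mul]
    simp only [degeneration, Matrix.map_apply, Matrix.of_apply, Matrix.add_apply,
      Matrix.smul_apply, smul_eq_mul, Polynomial.eval_add, Polynomial.eval_mul,
      Polynomial.eval_C, Polynomial.eval_pow, Polynomial.eval_X, mul_add, add_mul]
    congr 1
    · by_cases h : M a b = 0
      · simp [h]
      have h1 := snd_le_snd_of_apply_ne_zero hM h
      have h2 := rowLen_add_le_of_apply_ne_zero hM h
      rw [mul_right_comm, ← zpow_add₀ ht, mul_comm, ← zpow_natCast, Nat.cast_sub (by lia)]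
      congr 2
      simp only [hw]
      push_cast
      ring
    · rw [jordanSecond_apply]
      split_ifs with h
      · have h1 : w b = w a + 2 := by
          simp only [hw, h]
          push_cast
          ring
        rw [h1, zpow_add₀ ht, zpow_neg]
        have := zpow_ne_zero (w a) ht
        norm_cast
        field_simp
      · simp
  rw [h]
  exact (Matrix.rank_mul_le_left _ _).trans (Matrix.rank_mul_le_right _ _)

theorem eventually_sumRankFinePow_add_rank_le [Infinite K]
    {M : Matrix (Fin T.card) (Fin T.card) K} (hM : Commute (jordanSecond K T) M) :
    ∀ᶠ t : K in Filter.cofinite,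
      sumRankFinePow T M + (jordanSecond K T).rank ≤ (M + t • jordanSecond K T).rank := by
  obtain ⟨s, hs, hs0⟩ := (((degeneration T M).eventually_rank_eval_le 0).and
    (Filter.eventually_cofinite_ne (0 : K))).exists
  rw [degeneration_map_eval_zero hM] at hs
  have hpencil : ∀ t : K, (Matrix.of fun a b => Polynomial.C (M a b) +
      Polynomial.C (jordanSecond K T a b) * Polynomial.X).map (Polynomial.eval t) =
      M + t • jordanSecond K T := fun t => by
    ext a b
    simp [mul_comm t]
  have h := Matrix.eventually_rank_eval_le (Matrix.of fun a b => Polynomial.C (M a b) +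
      Polynomial.C (jordanSecond K T a b) * Polynomial.X) (s ^ 2)⁻¹
  simp only [hpencil] at h
  filter_upwards [h] with t ht
  exact (sumRankFinePow_add_rank_le hM).trans (hs.trans ((rank_degeneration_le hM hs0).trans ht))

end JordanSecond

theorem IsMatrixOf.commute {K V ι : Type*} [Field K] [AddCommGroup V] [Module K V] [Fintype ι]
    [DecidableEq ι] {rows : Bool} {b : Module.Basis ι K V} {φ ψ : V →ₗ[K] V} {X Y : Matrix ι ι K}
    (hX : IsMatrixOf rows b φ X) (hY : IsMatrixOf rows b ψ Y) (h : Commute φ ψ) : Commute X Y := by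
  have h1 : Commute (LinearMap.toMatrix b b φ) (LinearMap.toMatrix b b ψ) := by
    rw [commute_iff_eq, ← LinearMap.toMatrix_mul, ← LinearMap.toMatrix_mul, h.eq]
  cases rows
  · simp only [IsMatrixOf, Bool.false_eq_true, if_false] at hX hY
    rwa [hX, hY]
  · simp only [IsMatrixOf, if_true] at hX hY
    rw [← hX, ← hY] at h1
    rw [commute_iff_eq, ← Matrix.transpose_inj, Matrix.transpose_mul, Matrix.transpose_mul]
    exact h1.eq.symm

theorem IsMatrixOf.add_smul {K V ι : Type*} [Field K] [AddCommGroup V] [Module K V] [Fintype ι]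
    [DecidableEq ι] {rows : Bool} {b : Module.Basis ι K V} {φ ψ : V →ₗ[K] V} {X Y : Matrix ι ι K}
    (hX : IsMatrixOf rows b φ X) (hY : IsMatrixOf rows b ψ Y) (t : K) :
    IsMatrixOf rows b (φ + t • ψ) (X + t • Y) := by
  cases rows
  · simp only [IsMatrixOf, Bool.false_eq_true, if_false] at hX hY ⊢
    rw [hX, hY, map_add, map_smul]
  · simp only [IsMatrixOf, if_true] at hX hY ⊢
    rw [Matrix.transpose_add, Matrix.transpose_smul, hX, hY, map_add, map_smul]

theorem IsMatrixOf.rank_eq {K V ι : Type*} [Field K] [AddCommGroup V] [Module K V] [Fintype ι]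
    [DecidableEq ι] {rows : Bool} {b : Module.Basis ι K V} {φ : V →ₗ[K] V} {X : Matrix ι ι K}
    (hX : IsMatrixOf rows b φ X) : X.rank = Module.finrank K (LinearMap.range φ) := by
  have h := (LinearMap.toMatrix b b φ).rank_eq_finrank_range_toLin b b
  rw [Matrix.toLin_toMatrix] at h
  cases rows
  · simp only [IsMatrixOf, Bool.false_eq_true, if_false] at hX
    rw [hX, h]
  · simp only [IsMatrixOf, if_true] at hX
    rw [← Matrix.rank_transpose, hX, h]

theorem mainTheorem1 {K A : Type*} [Field K] [Infinite K] [CommRing A] [Algebra K A]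
    [IsArtinianRing A] (𝒜 : ℕ → Submodule K A) [GradedAlgebra 𝒜] (c : ℕ)
    (h𝒜 : IsStandardGrading 𝒜 c)
    (z y : A) (hz : z ∈ 𝒜 1) (hy : y ∈ 𝒜 1) (hzy : LinearIndependent K ![z, y])
    (T : YoungDiagram) (b : Module.Basis (Fin T.card) K A) (rows : Bool)
    (J M : Matrix (Fin T.card) (Fin T.card) K)
    (hJ : IsMatrixOf rows b (LinearMap.mulLeft K z) J)
    (hM : IsMatrixOf rows b (LinearMap.mulLeft K y) M)
    (hJT : J = JordanSecond.jordanSecond K T) :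
    (∀ᶠ t : K in Filter.cofinite,
        JordanSecond.sumRankFinePow T M + J.rank ≤ (M + t • J).rank) ∧
      (JordanSecond.sumRankFinePow T M + J.rank = coSperner 𝒜 c →
        ∀ᶠ t : K in Filter.cofinite, IsWeakLefschetzElement 𝒜 c (y + t • z)) := by
  have : FiniteDimensional K A := Module.Basis.finiteDimensional_of_finite b
  have hcomm : Commute (LinearMap.mulLeft K z) (LinearMap.mulLeft K y) :=
    LinearMap.ext fun a => mul_left_comm z y a
  have hJM := hJ.commute hM hcomm
  subst hJT
  have h := JordanSecond.eventually_sumRankFinePow_add_rank_le hJM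
  refine ⟨h, fun heq => ?_⟩
  filter_upwards [h] with t ht
  refine isWeakLefschetzElement_of_coSperner_le 𝒜 h𝒜.eq_bot_of_lt
    (add_mem hy (Submodule.smul_mem _ t hz)) ?_
  have hl : LinearMap.mulLeft K (y + t • z) =
      LinearMap.mulLeft K y + t • LinearMap.mulLeft K z := by
    ext a
    simp [add_mul]
  rw [hl, ← (hM.add_smul hJ t).rank_eq, ← heq]
  exact ht
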